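/- There is an absolute constant $C>0$ such that the following holds. Let $f:\mathbb{R}^d\to\mathbb{R}$ be convex, $x_0\in\mathbb{R}^d$, $\eta_0=\epsilon>0$ and $\gamma\ge 0$. AdaGrad++ with damping $\gamma$ produces, for $t=0,1,2,\dots$, $$s_t=\Big(\sum_{k=0}^t g_k^2\Big)^{1/2},\qquad x_{t+1}=x_t-\eta_t\,(\gamma I+\mathrm{diag}(s_t))^{-1}g_t,\qquad \eta_{t+1}=\max\Big(\eta_t,\frac{\|x_{t+1}-x_0\|_2}{\sqrt d}\Big),$$ where squares and roots are taken entrywise, $g_t$ is the answer of a stochastic gradient oracle at $x_t$, and, if $\gamma=0$, a coordinate in which $g_0,\dots,g_t$ all vanish does not move. Assume that the conditional mean of $g_t$, given the history before the query at $x_t$, almost surely belongs to $\partial f(x_t)$, and that for some continuous $l:\mathbb{R}^d\to\mathbb{R}$ one has $\|g_t\|_2\le l(x_t)$ almost surely for every $t$. Let $T\ge 1$, $\delta\in(0,1)$, $L>0$ and $x_*\in\mathbb{R}^d$. Write $$D_\tau=\max_{t\le \tau}\|x_t-x_*\|_\infty,\quad \overline D_\tau=\max_{t\le\tau}\|x_t-x_*\|_2,\quad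 \theta_{t,\delta}=\log\frac{60\log(6t)}{\delta},\quad \log_+z=1+\log z .$$ Then with probability at least $1-\delta-\mathbb{P}(\max_{t\le T}l(x_t)>L)$, every maximizer $\tau$ of $t\mapsto\sum_{i=0}^{t-1}\eta_i/\eta_t$ over $0\le t\le T$, with $\overline x_\tau=\sum_{t=0}^{\tau-1}\eta_tx_t\big/\sum_{t=0}^{\tau-1}\eta_t$, satisfies $$f(\overline x_\tau)\le f(x_*)+C\,\frac{W_\tau+\overline D_\tau\,\eta_0\sqrt{\theta_{\tau,\delta}\|s_\tau\|_2^2+L^2\theta_{\tau,\delta}^2}}{T\eta_0}\,\log_+\!\Big(\frac{\eta_T}{\eta_0}\Big)$$ with $W_\tau=\max(D_\tau,\eta_0)^2\big(\sqrt d\,\|s_\tau\|_2+d\gamma\big)$ and, if $\gamma=0$, also with $W_\tau=D_\tau^2\sqrt d\,\|s_\tau\|_2$. -/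

import Mathlib

open MeasureTheory

noncomputable section

namespace AdaGradPP

/-- The space `ℝ^d` with its Euclidean norm. -/
abbrev Vec (d : ℕ) : Type := EuclideanSpace ℝ (Fin d)

/-- `v ∈ ∂f(x)`: the vector `v` is a subgradient of `f` at `x`. -/
def IsSubgradientAt {d : ℕ} (f : Vec d → ℝ) (x v : Vec d) : Prop :=
  ∀ y : Vec d, f x + inner ℝ v (y - x) ≤ f y

/-- The supremum norm `‖v‖_∞ = max_i |v_i|` of a vector of `ℝ^d`. -/
def supNorm {d : ℕ} (v : Vec d) : ℝ := ‖(v.ofLp : Fin d → ℝ)‖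

/-- The maximum of `a 0, …, a n`. -/
def runMax (a : ℕ → ℝ) (n : ℕ) : ℝ :=
  (Finset.range (n + 1)).sup' ⟨0, Finset.mem_range.2 n.succ_pos⟩ a

/-- The entrywise root of the accumulated squared gradients,
`s_t = (∑_{k ≤ t} g_k ^ 2) ^ (1/2)`. -/
def accum {d : ℕ} (g : ℕ → Vec d) (t : ℕ) : Vec d :=
  WithLp.toLp 2 fun i => Real.sqrt (∑ k ∈ Finset.range (t + 1), (g k i) ^ 2)

/-- The pair `(x_t, η_t)` of AdaGrad++ started at `x₀` with initial step size `ε` and damping `γ`,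
when the stochastic gradient received at the iterate `x_k` is `g k`:
`x_{t+1} = x_t - η_t (γ + diag s_t)⁻¹ g_t` and `η_{t+1} = max (η_t, ‖x_{t+1} - x₀‖₂ / √d)`.
If `γ = 0` and the `i`-th entry of `s_t` vanishes, then so does that of `g_t`, and the `i`-th
coordinate does not move (`0⁻¹ = 0`). -/
def state {d : ℕ} (x₀ : Vec d) (ε γ : ℝ) (g : ℕ → Vec d) : ℕ → Vec d × ℝ
  | 0 => (x₀, ε)
  | t + 1 =>
    let x : Vec d := WithLp.toLp 2 fun i =>
      (state x₀ ε γ g t).1 i - (state x₀ ε γ g t).2 * ((γ + accum g t i)⁻¹ * g t i)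
    (x, max (state x₀ ε γ g t).2 (‖x - x₀‖ / Real.sqrt d))

/-- The iterate `x_t`; it depends on `g 0, …, g (t - 1)` only. -/
def iter {d : ℕ} (x₀ : Vec d) (ε γ : ℝ) (g : ℕ → Vec d) (t : ℕ) : Vec d :=
  (state x₀ ε γ g t).1

/-- The step size `η_t`. -/
def step {d : ℕ} (x₀ : Vec d) (ε γ : ℝ) (g : ℕ → Vec d) (t : ℕ) : ℝ :=
  (state x₀ ε γ g t).2

/-- `g` is the sequence of answers of an unbiased stochastic subgradient oracle for `f` along the
run of AdaGrad++ that it drives. Here `ℱ t` is the information available when the oracle is queried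
at `x_t`, i.e. before `g t` is revealed, and the conditional mean of the answer `g t` is a
subgradient of `f` at `x_t`. -/
structure IsOracleRun {d : ℕ} {Ω : Type*} {mΩ : MeasurableSpace Ω} (μ : Measure Ω)
    (ℱ : Filtration ℕ mΩ) (f : Vec d → ℝ) (x₀ : Vec d) (ε γ : ℝ) (g : ℕ → Ω → Vec d) : Prop where
  measurable : ∀ t, StronglyMeasurable[ℱ (t + 1)] (g t)
  subgradient : ∀ t, ∀ᵐ ω ∂μ,
    IsSubgradientAt f (iter x₀ ε γ (fun k => g k ω) t) ((μ[g t | ℱ t]) ω)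

/-- `τ` maximizes `t ↦ ∑_{i < t} η_i / η_t` over `t ≤ T`. -/
def IsBestTime (η : ℕ → ℝ) (T τ : ℕ) : Prop :=
  τ ≤ T ∧ ∀ t ≤ T,
    ∑ i ∈ Finset.range t, η i / η t ≤ ∑ i ∈ Finset.range τ, η i / η τ

/-- The weighted average `(∑_{t < τ} η_t x_t) / ∑_{t < τ} η_t`. -/
def weightedAvg {d : ℕ} (η : ℕ → ℝ) (x : ℕ → Vec d) (τ : ℕ) : Vec d :=
  (∑ t ∈ Finset.range τ, η t)⁻¹ • ∑ t ∈ Finset.range τ, η t • x t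

/-- `θ_{t,δ} = log (60 log (6 t) / δ)`. -/
def theta (t : ℕ) (δ : ℝ) : ℝ := Real.log (60 * Real.log (6 * t) / δ)

/-- `log₊ z = 1 + log z`. -/
def logPlus (z : ℝ) : ℝ := 1 + Real.log z

/-- The right-hand side of the convergence rate at time `τ`, up to an absolute constant:
`(W + D̄_τ η_0 √(θ_{τ,δ} ‖s_τ‖₂² + L² θ_{τ,δ}²)) / (T η_0) * log₊ (η_T / η_0)`,
where `W` is the contribution of the squared distance and `D̄_τ = max_{t ≤ τ} ‖x_t - x_*‖₂`. -/
def rate {d : ℕ} (η : ℕ → ℝ) (x : ℕ → Vec d) (s : ℕ → Vec d) (xs : Vec d) (δ L : ℝ) (T τ : ℕ)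
    (W : ℝ) : ℝ :=
  (W + runMax (fun t => ‖x t - xs‖) τ * η 0 *
      Real.sqrt (theta τ δ * ‖s τ‖ ^ 2 + L ^ 2 * theta τ δ ^ 2)) / (T * η 0) *
    logPlus (η T / η 0)

/-- The conclusion of the theorem for one realization `g` of the stochastic gradients: at every
maximizer `τ`, with `D_τ = max_{t ≤ τ} ‖x_t - x_*‖_∞`, the optimality gap is at most `C` times the
rate with `W = max(D_τ, η_0)² (√d ‖s_τ‖₂ + d γ)`, and even with `W = D_τ² √d ‖s_τ‖₂` if there is
no damping. -/
def GapBound {d : ℕ} (C : ℝ) (f : Vec d → ℝ) (x₀ : Vec d) (ε γ : ℝ) (xs : Vec d) (δ L : ℝ) (T : ℕ)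
    (g : ℕ → Vec d) : Prop :=
  ∀ τ : ℕ, IsBestTime (step x₀ ε γ g) T τ →
    (γ = 0 →
      f (weightedAvg (step x₀ ε γ g) (iter x₀ ε γ g) τ) ≤ f xs +
        C * rate (step x₀ ε γ g) (iter x₀ ε γ g) (accum g) xs δ L T τ
          (runMax (fun t => supNorm (iter x₀ ε γ g t - xs)) τ ^ 2 *
            Real.sqrt d * ‖accum g τ‖)) ∧
    f (weightedAvg (step x₀ ε γ g) (iter x₀ ε γ g) τ) ≤ f xs +
      C * rate (step x₀ ε γ g) (iter x₀ ε γ g) (accum g) xs δ L T τ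
        (max (runMax (fun t => supNorm (iter x₀ ε γ g t - xs)) τ) ε ^ 2 *
          (Real.sqrt d * ‖accum g τ‖ + d * γ))

end AdaGradPP

end

/-! Jensen's inequality and the subgradient inequality at the conditional means bound `(∑ η_t) (f
x̄_τ - f x_*)` by the linear regret of the observed gradients minus a noise term. The regret is the
AdaGrad potential argument, coordinate by coordinate (`sum_coord_le`); since `η_τ ≤ max (ε, 2 D_τ)`,
it costs at most `5 (η_τ / ε) W_τ`.

In the noise, Abel summation removes the nondecreasing weight `η_t D̄_t` (`abs_noise_le`), leaving a
martingale along predictable directions of the unit ball. For increments `|u| ≤ 1/2`, `exp ∑ (u - E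
u - 2 u²)` is a supermartingale, so Ville's inequality controls the noise by the observed squares,
that is by `‖s_τ‖²`. Doing this at all dyadic scales and for both signs allows the scale to be
chosen after seeing the data. About `log τ` scales matter at time `τ`, so summable confidence levels
cost only `log log τ`, which is the form of `θ` (`exists_scale`, `abs_le_of_scales`).

Finally, at a best time `∑ η_i ≥ T η_τ / (2 log₊ (η_T / η_0))` (`le_of_ratio_le`), and this `η_τ`
cancels the one in the regret and noise bounds. -/

namespace AdaGradPP

/-! ### Maximal inequality and self-normalized concentration. -/

section Concentration

variable {Ω : Type*} {mΩ : MeasurableSpace Ω} {μ : Measure Ω} {ℱ : Filtration ℕ mΩ}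

/-- Ville's maximal inequality on a finite horizon. -/
theorem ville_ineq [IsFiniteMeasure μ] {M : ℕ → Ω → ℝ} (hM : Supermartingale M ℱ μ)
    (hM0 : ∀ n ω, 0 ≤ M n ω) (a : ℝ) (n : ℕ) :
    a * μ.real {ω | ∃ k ≤ n, a ≤ M k ω} ≤ ∫ ω, M 0 ω ∂μ := by
  have hmeas : ∀ k, Measurable[ℱ k] (M k) := fun k => (hM.stronglyAdapted k).measurable
  have hlt : ∀ n, MeasurableSet[ℱ n] {ω | ∀ k ≤ n, M k ω < a} := by
    intro n
    have : {ω | ∀ k ≤ n, M k ω < a} = ⋂ k ∈ Finset.range (n + 1), {ω | M k ω < a} := by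
      ext ω; simp
    rw [this]
    refine Finset.measurableSet_biInter _ fun k hk => ?_
    have hk' : k ≤ n := Nat.lt_succ_iff.1 (Finset.mem_range.1 hk)
    exact measurableSet_lt ((hmeas k).mono (ℱ.mono hk') le_rfl) measurable_const
  -- First passage without stopping times: paths that have crossed count as `a`, the others carry
  -- their current value of `M`.
  have hstep : ∀ n, a * μ.real {ω | ∃ k ≤ n, a ≤ M k ω}
      + ∫ ω in {ω | ∀ k ≤ n, M k ω < a}, M n ω ∂μ ≤ ∫ ω, M 0 ω ∂μ := by
    intro n
    induction n with
    | zero =>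
      have hms : MeasurableSet {ω | M 0 ω < a} := by
        simpa using ℱ.le 0 _ (hlt 0)
      have hsplit := integral_add_compl hms (hM.integrable 0)
      have hc : {ω | M 0 ω < a}ᶜ = {ω | a ≤ M 0 ω} := by ext; simp
      rw [hc] at hsplit
      have := setIntegral_ge_of_const_le_real (μ := μ) (c := a)
        (s := {ω | a ≤ M 0 ω}) (by rw [← hc]; exact hms.compl)
        (measure_ne_top μ _) (fun ω hω => hω) (hM.integrable 0).integrableOn
      simp only [Nat.le_zero, exists_eq_left, forall_eq]
      linarith
    | succ n ih =>
      have h1 := hM.setIntegral_le (Nat.le_succ n) (hlt n)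
      set A := {ω | ∀ k ≤ n, M k ω < a} with hA
      set A' := {ω | ∀ k ≤ n + 1, M k ω < a} with hA'
      have hmA : MeasurableSet A := ℱ.le _ _ (hlt n)
      have hmA' : MeasurableSet A' := ℱ.le _ _ (hlt (n + 1))
      have hsub : A' ⊆ A := fun ω hω k hk => hω k (hk.trans n.le_succ)
      have hsplit : ∫ ω in A, M (n + 1) ω ∂μ
          = ∫ ω in A', M (n + 1) ω ∂μ + ∫ ω in A \ A', M (n + 1) ω ∂μ := by
        rw [← setIntegral_union Set.disjoint_sdiff_right (hmA.diff hmA')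
          (hM.integrable _).integrableOn (hM.integrable _).integrableOn,
          Set.union_sdiff_cancel hsub]
      have hge := setIntegral_ge_of_const_le_real (μ := μ) (c := a) (hmA.diff hmA')
        (measure_ne_top μ _) (f := M (n + 1)) (fun ω hω => by
          by_contra hcon
          exact hω.2 fun k hk => (Nat.le_succ_iff.1 hk).elim (fun h => hω.1 k h)
            fun h => h ▸ not_le.1 hcon) (hM.integrable _).integrableOn
      have hc : {ω | ∃ k ≤ n, a ≤ M k ω} = Aᶜ := by ext; simp [hA]
      have hc' : {ω | ∃ k ≤ n + 1, a ≤ M k ω} = A'ᶜ := by ext; simp [hA']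
      have hunion : A'ᶜ = Aᶜ ∪ A \ A' := by
        ext ω
        by_cases h : ω ∈ A
        · simp [h]
        · have h' : ω ∉ A' := fun h' => h (hsub h')
          simp [h, h']
      rw [hc] at ih
      have hdisj : Disjoint Aᶜ (A \ A') := Set.disjoint_left.2 fun ω h h' => h h'.1
      rw [hc', hunion, measureReal_union hdisj (hmA.diff hmA')]
      linarith
  have := hstep n
  have h0 : 0 ≤ ∫ ω in {ω | ∀ k ≤ n, M k ω < a}, M n ω ∂μ :=
    integral_nonneg fun ω => hM0 n ω
  linarith

/-- Compare `exp u ≤ 1 + u + u²` with `(1 + u) (1 + 2 u²)`; the difference is `u² (1 + 2 u) ≥ 0`. -/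
theorem exp_sub_two_mul_sq_le {u : ℝ} (hu : |u| ≤ 1 / 2) : Real.exp (u - 2 * u ^ 2) ≤ 1 + u := by
  have h1 := (abs_le.1 (Real.abs_exp_sub_one_sub_id_le (x := u) (by linarith))).2
  obtain ⟨hl, hr⟩ := abs_le.1 hu
  have h2 := Real.add_one_le_exp (2 * u ^ 2)
  rw [Real.exp_sub, div_le_iff₀ (Real.exp_pos _)]
  nlinarith [mul_le_mul_of_nonneg_left h2 (show 0 ≤ 1 + u by linarith), sq_nonneg u,
    mul_nonneg (sq_nonneg u) (show 0 ≤ 1 + 2 * u by linarith)]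

/-- The exponential process of a martingale difference sequence compensated by twice its squared
uncentered increments. -/
noncomputable def expCompensated (μ : Measure Ω) (ℱ : Filtration ℕ mΩ) (u : ℕ → Ω → ℝ)
    (n : ℕ) (ω : Ω) : ℝ :=
  Real.exp (∑ i ∈ Finset.range n, (u i ω - (μ[u i | ℱ i]) ω - 2 * u i ω ^ 2))

/-- With `m` the conditional mean of `u`, one step multiplies the process by at most `exp (-m) (1 +
u)`, whose conditional mean `exp (-m) (1 + m)` is at most `1`. The compensator uses observed
squares, so no conditional variance appears. -/
theorem supermartingale_expCompensated [IsFiniteMeasure μ] {u : ℕ → Ω → ℝ}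
    (hu : ∀ i, StronglyMeasurable[ℱ (i + 1)] (u i)) (hb : ∀ i, ∀ᵐ ω ∂μ, |u i ω| ≤ 1 / 2) :
    Supermartingale (expCompensated μ ℱ u) ℱ μ := by
  have hce : ∀ i, StronglyMeasurable[ℱ i] (μ[u i | ℱ i]) := fun i => stronglyMeasurable_condExp
  have hcb : ∀ i, ∀ᵐ ω ∂μ, |(μ[u i | ℱ i]) ω| ≤ 1 / 2 := fun i =>
    ae_bdd_norm_condExp_of_ae_bdd_norm (f := u i) (hb i)
  have hui : ∀ i, Integrable (u i) μ := fun i =>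
    Integrable.of_bound ((hu i).mono (ℱ.le _)).aestronglyMeasurable (1 / 2) (hb i)
  have hadapt : StronglyAdapted ℱ (expCompensated μ ℱ u) := by
    intro n
    refine Real.continuous_exp.comp_stronglyMeasurable ?_
    refine Finset.stronglyMeasurable_fun_sum _ fun i hi => ?_
    have hin : i + 1 ≤ n := Finset.mem_range.1 hi
    have h1 : StronglyMeasurable[ℱ n] (u i) := (hu i).mono (ℱ.mono hin)
    have h2 : StronglyMeasurable[ℱ n] (μ[u i | ℱ i]) := (hce i).mono (ℱ.mono (by omega))
    exact (h1.sub h2).sub ((h1.pow 2).const_mul 2)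
  have hbound : ∀ n, ∀ᵐ ω ∂μ, ‖expCompensated μ ℱ u n ω‖ ≤ Real.exp n := by
    intro n
    filter_upwards [ae_all_iff.2 hb, ae_all_iff.2 hcb] with ω h1 h2
    rw [expCompensated, Real.norm_of_nonneg (Real.exp_nonneg _), Real.exp_le_exp]
    calc _ ≤ ∑ i ∈ Finset.range n, (1 : ℝ) := by
          refine Finset.sum_le_sum fun i _ => ?_
          have := (abs_le.1 (h1 i)).2
          have := (abs_le.1 (h2 i)).1
          nlinarith [sq_nonneg (u i ω)]
      _ = n := by simp
  have hint : ∀ n, Integrable (expCompensated μ ℱ u n) μ := fun n =>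
    Integrable.of_bound ((hadapt n).mono (ℱ.le _)).aestronglyMeasurable _ (hbound n)
  refine supermartingale_nat hadapt hint fun n => ?_
  set P : Ω → ℝ := fun ω => expCompensated μ ℱ u n ω * Real.exp (-(μ[u n | ℱ n]) ω) with hP
  have hPm : StronglyMeasurable[ℱ n] P :=
    (hadapt n).mul (Real.continuous_exp.comp_stronglyMeasurable (hce n).neg)
  have hPb : ∀ᵐ ω ∂μ, ‖P ω‖ ≤ Real.exp n * Real.exp 1 := by
    filter_upwards [hbound n, hcb n] with ω h1 h2
    rw [hP, norm_mul]
    refine mul_le_mul h1 ?_ (norm_nonneg _) (Real.exp_nonneg _)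
    rw [Real.norm_of_nonneg (Real.exp_nonneg _), Real.exp_le_exp]
    linarith [(abs_le.1 h2).1]
  have h1u : Integrable (fun ω => 1 + u n ω) μ := (integrable_const 1).add (hui n)
  have hle : expCompensated μ ℱ u (n + 1) ≤ᵐ[μ] fun ω => P ω * (1 + u n ω) := by
    filter_upwards [hb n] with ω h
    rw [expCompensated, Finset.sum_range_succ, Real.exp_add, hP, mul_assoc]
    refine mul_le_mul_of_nonneg_left ?_ (Real.exp_nonneg _)
    rw [show u n ω - (μ[u n | ℱ n]) ω - 2 * u n ω ^ 2
      = -(μ[u n | ℱ n]) ω + (u n ω - 2 * u n ω ^ 2) by ring, Real.exp_add]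
    exact mul_le_mul_of_nonneg_left (exp_sub_two_mul_sq_le h) (Real.exp_nonneg _)
  have hPint : Integrable (fun ω => P ω * (1 + u n ω)) μ :=
    h1u.bdd_mul (hPm.mono (ℱ.le _)).aestronglyMeasurable hPb
  have hpull := condExp_stronglyMeasurable_mul_of_bound (ℱ.le n) hPm h1u _ hPb
  have hadd := condExp_add (integrable_const (μ := μ) (1 : ℝ)) (hui n) (ℱ n)
  filter_upwards [condExp_mono (m := ℱ n) (hint (n + 1)) hPint hle, hpull, hadd]
    with ω h1 h2 h3
  refine h1.trans ?_
  have h4 : (μ[fun ω => P ω * (1 + u n ω) | ℱ n]) ω = P ω * (1 + (μ[u n | ℱ n]) ω) := by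
    have h3' : (μ[fun ω => 1 + u n ω | ℱ n]) ω = 1 + (μ[u n | ℱ n]) ω := by
      simpa [condExp_const (ℱ.le n), Pi.add_def] using h3
    rw [← h3']
    exact h2
  rw [h4, hP, mul_assoc]
  refine mul_le_of_le_one_right (Real.exp_nonneg _) ?_
  rw [Real.exp_neg, inv_mul_le_one₀ (Real.exp_pos _), add_comm]
  exact Real.add_one_le_exp _

theorem measureReal_exists_le_sum_le_exp [IsProbabilityMeasure μ] {u : ℕ → Ω → ℝ}
    (hu : ∀ i, StronglyMeasurable[ℱ (i + 1)] (u i)) (hb : ∀ i, ∀ᵐ ω ∂μ, |u i ω| ≤ 1 / 2)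
    (b : ℝ) (n : ℕ) :
    μ.real {ω | ∃ k ≤ n, b ≤ ∑ i ∈ Finset.range k,
      (u i ω - (μ[u i | ℱ i]) ω - 2 * u i ω ^ 2)} ≤ Real.exp (-b) := by
  have h := ville_ineq (supermartingale_expCompensated hu hb)
    (fun n ω => Real.exp_nonneg _) (Real.exp b) n
  simp only [expCompensated, Finset.range_zero, Finset.sum_empty, Real.exp_zero, integral_const,
    probReal_univ, smul_eq_mul, mul_one, Real.exp_le_exp] at h
  rw [Real.exp_neg, ← one_div, le_div_iff₀ (Real.exp_pos b), mul_comm]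
  exact h

/-- Self-normalized concentration of the predictable linear functionals `⟪h i, ·⟫` of the noise
of a vector-valued sequence `g`. -/
theorem measureReal_exists_le_sum_inner_le_exp [IsProbabilityMeasure μ] {E : Type*}
    [NormedAddCommGroup E] [InnerProductSpace ℝ E] [CompleteSpace E] {g h : ℕ → Ω → E}
    (hg : ∀ i, StronglyMeasurable[ℱ (i + 1)] (g i)) (hgi : ∀ i, Integrable (g i) μ)
    (hh : ∀ i, StronglyMeasurable[ℱ i] (h i)) {c : ℝ} (hhb : ∀ i ω, ‖h i ω‖ ≤ c)
    (hb : ∀ i, ∀ᵐ ω ∂μ, |inner ℝ (h i ω) (g i ω)| ≤ 1 / 2) (b : ℝ) (n : ℕ) :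
    μ.real {ω | ∃ k ≤ n, b ≤ ∑ i ∈ Finset.range k,
      (inner ℝ (h i ω) (g i ω - (μ[g i | ℱ i]) ω) - 2 * inner ℝ (h i ω) (g i ω) ^ 2)}
        ≤ Real.exp (-b) := by
  have hu : ∀ i, StronglyMeasurable[ℱ (i + 1)] fun ω => inner ℝ (h i ω) (g i ω) := fun i =>
    StronglyMeasurable.inner ((hh i).mono (ℱ.mono i.le_succ)) (hg i)
  refine le_trans (le_of_eq (measureReal_congr ?_))
    (measureReal_exists_le_sum_le_exp hu hb b n)
  have hpull : ∀ i, μ[fun ω => inner ℝ (h i ω) (g i ω) | ℱ i]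
      =ᵐ[μ] fun ω => inner ℝ (h i ω) ((μ[g i | ℱ i]) ω) := fun i =>
    condExp_stronglyMeasurable_bilin_of_bound (innerSL ℝ) (ℱ.le i) (hh i) (hgi i) c
      (ae_of_all _ (hhb i))
  filter_upwards [ae_all_iff.2 hpull] with ω hω
  refine propext (exists_congr fun k => and_congr_right fun _ => ?_)
  simp only [hω, inner_sub_right]

end Concentration

end AdaGradPP

namespace AdaGradPP

/-! ### Running maxima. -/

section RunMax

theorem le_runMax (a : ℕ → ℝ) {k n : ℕ} (h : k ≤ n) : a k ≤ runMax a n :=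
  Finset.le_sup' a (Finset.mem_range.2 (Nat.lt_succ_of_le h))

theorem runMax_le {a : ℕ → ℝ} {n : ℕ} {c : ℝ} (h : ∀ k ≤ n, a k ≤ c) : runMax a n ≤ c :=
  Finset.sup'_le _ _ fun k hk => h k (Nat.lt_succ_iff.1 (Finset.mem_range.1 hk))

theorem runMax_mono (a : ℕ → ℝ) : Monotone (runMax a) :=
  fun _ _ hmn => runMax_le fun _ hk => le_runMax a (hk.trans hmn)

end RunMax

/-! ### The best time and the logarithmic factor. -/

section BestTime

/-- Let `A_t` be the ratio sum and `r = η_t / η_{t+1}`. Then `A_{t+1} = (A_t + 1) r` falls short of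
`A_t + 1` by at most `(M + 1) (1 - r) ≤ -(M + 1) log r`, and the logarithms telescope. -/
theorem le_of_ratio_le {η : ℕ → ℝ} (hη : Monotone η) (h0 : 0 < η 0) {T : ℕ} {M : ℝ} (hM : 1 ≤ M)
    (h : ∀ t ≤ T, ∑ i ∈ Finset.range t, η i / η t ≤ M) :
    T ≤ 2 * M * logPlus (η T / η 0) := by
  have hpos : ∀ t, 0 < η t := fun t => h0.trans_le (hη t.zero_le)
  have key : ∀ t ≤ T, (t : ℝ) ≤
      ∑ i ∈ Finset.range t, η i / η t + (M + 1) * Real.log (η t / η 0) := by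
    intro t
    induction t with
    | zero => simp [div_self h0.ne']
    | succ t ih =>
      intro ht
      have ih := ih (by omega)
      have hA := h t (by omega)
      set A := ∑ i ∈ Finset.range t, η i / η t with hAdef
      set r := η t / η (t + 1) with hr
      have hrpos : 0 < r := div_pos (hpos _) (hpos _)
      have hr1 : r ≤ 1 := (div_le_one (hpos _)).2 (hη t.le_succ)
      have hsum : ∑ i ∈ Finset.range (t + 1), η i / η (t + 1) = (A + 1) * r := by
        rw [Finset.sum_range_succ, add_mul, hAdef, Finset.sum_mul, one_mul, ← hr]
        congr 1
        refine Finset.sum_congr rfl fun i _ => ?_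
        rw [hr, div_mul_div_cancel₀ (hpos t).ne']
      have hlog : Real.log (η (t + 1) / η 0) = Real.log (η t / η 0) - Real.log r := by
        rw [← Real.log_div (div_pos (hpos _) h0).ne' hrpos.ne', hr]
        congr 1
        have := (hpos t).ne'; have := (hpos (t + 1)).ne'
        field_simp
      have hlr := Real.log_le_sub_one_of_pos hrpos
      rw [hsum, hlog]
      push_cast
      nlinarith [mul_nonneg (sub_nonneg.2 hA) (sub_nonneg.2 hr1)]
  have hlog : 0 ≤ Real.log (η T / η 0) :=
    Real.log_nonneg ((one_le_div h0).2 (hη T.zero_le))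
  have := key T le_rfl
  have := h T le_rfl
  unfold logPlus
  nlinarith

/-- The competitor `t = 1` has ratio sum `η 0 / η 1 = 1`, which supplies `1 ≤ M`. -/
theorem IsBestTime.le_two_mul {η : ℕ → ℝ} (hη : Monotone η) (h0 : 0 < η 0) (h1 : η 1 = η 0)
    {T τ : ℕ} (hT : 1 ≤ T) (h : IsBestTime η T τ) :
    T ≤ 2 * (∑ i ∈ Finset.range τ, η i / η τ) * logPlus (η T / η 0) :=
  le_of_ratio_le hη h0 (by simpa [h1, h0.ne'] using h.2 1 hT) h.2

theorem IsBestTime.one_le {η : ℕ → ℝ} (h0 : 0 < η 0) (h1 : η 1 = η 0)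
    {T τ : ℕ} (hT : 1 ≤ T) (h : IsBestTime η T τ) : 1 ≤ τ := by
  rcases Nat.eq_zero_or_pos τ with rfl | hτ
  · have := h.2 1 hT
    simp [h1, h0.ne'] at this
    linarith
  · exact hτ

end BestTime

/-! ### Summation by parts. -/

section Abel

/-- Abel summation: weights that are nonnegative and nondecreasing. -/
theorem abs_sum_mul_le_of_monotone {y X : ℕ → ℝ} (hy : Monotone y) (hy0 : 0 ≤ y 0) {n : ℕ} {B : ℝ}
    (hB : ∀ k ≤ n, |∑ i ∈ Finset.range k, X i| ≤ B) :
    |∑ i ∈ Finset.range n, y i * X i| ≤ 2 * y n * B := by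
  have hB0 : 0 ≤ B := (abs_nonneg _).trans (hB 0 n.zero_le)
  -- The difference is the sum of the increments of `y` times partial sums of `X`, hence the factor
  -- `y m - y 0`.
  have key : ∀ m ≤ n, |y m * ∑ i ∈ Finset.range m, X i - ∑ i ∈ Finset.range m, y i * X i|
      ≤ (y m - y 0) * B := by
    intro m
    induction m with
    | zero => simp
    | succ m ih =>
      intro hm
      have ih := ih (by omega)
      have hd : 0 ≤ y (m + 1) - y m := sub_nonneg.2 (hy m.le_succ)
      have h2 : |(y (m + 1) - y m) * ∑ i ∈ Finset.range (m + 1), X i|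
          ≤ (y (m + 1) - y m) * B := by
        rw [abs_mul, abs_of_nonneg hd]
        exact mul_le_mul_of_nonneg_left (hB _ hm) hd
      have h3 : y (m + 1) * ∑ i ∈ Finset.range (m + 1), X i - ∑ i ∈ Finset.range (m + 1), y i * X i
          = (y (m + 1) - y m) * ∑ i ∈ Finset.range (m + 1), X i
            + (y m * ∑ i ∈ Finset.range m, X i - ∑ i ∈ Finset.range m, y i * X i) := by
        simp only [Finset.sum_range_succ]; ring
      rw [h3]
      refine (abs_add_le _ _).trans ?_
      linarith
  have hyn : 0 ≤ y n := hy0.trans (hy n.zero_le)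
  have h1 := abs_le.1 (key n le_rfl)
  have h2 : |y n * ∑ i ∈ Finset.range n, X i| ≤ y n * B := by
    rw [abs_mul, abs_of_nonneg hyn]
    exact mul_le_mul_of_nonneg_left (hB n le_rfl) hyn
  have h2 := abs_le.1 h2
  have := mul_nonneg hy0 hB0
  rw [abs_le]
  constructor <;> nlinarith

end Abel

/-! ### Euclidean and supremum norms. -/

section Norms

variable {d : ℕ}

theorem abs_apply_le_supNorm (v : Vec d) (i : Fin d) : |v i| ≤ supNorm v :=
  norm_le_pi_norm (v.ofLp : Fin d → ℝ) i

theorem supNorm_nonneg (v : Vec d) : 0 ≤ supNorm v := norm_nonneg _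

theorem norm_le_sqrt_mul {v : Vec d} {c : ℝ} (hc : 0 ≤ c) (h : ∀ i, |v i| ≤ c) :
    ‖v‖ ≤ Real.sqrt d * c := by
  rw [EuclideanSpace.norm_eq]
  refine Real.sqrt_le_iff.2 ⟨by positivity, ?_⟩
  rw [mul_pow, Real.sq_sqrt (Nat.cast_nonneg d)]
  calc ∑ i, ‖v i‖ ^ 2 ≤ ∑ _i : Fin d, c ^ 2 :=
        Finset.sum_le_sum fun i _ => pow_le_pow_left₀ (norm_nonneg _) (h i) 2
    _ = d * c ^ 2 := by simp

theorem norm_div_sqrt_le {v : Vec d} {c : ℝ} (hc : 0 ≤ c) (h : ∀ i, |v i| ≤ c) :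
    ‖v‖ / Real.sqrt d ≤ c :=
  div_le_of_le_mul₀ (Real.sqrt_nonneg _) hc (by rw [mul_comm]; exact norm_le_sqrt_mul hc h)

theorem sum_le_sqrt_mul_norm (v : Vec d) : ∑ i, v i ≤ Real.sqrt d * ‖v‖ := by
  rw [EuclideanSpace.norm_eq, ← Real.sqrt_mul (Nat.cast_nonneg d)]
  refine Real.le_sqrt_of_sq_le ?_
  have := sq_sum_le_card_mul_sum_sq (s := (Finset.univ : Finset (Fin d))) (f := fun i => v i)
  simpa using this

theorem inner_eq_sum (u v : Vec d) : inner ℝ u v = ∑ i, u i * v i := by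
  simp [PiLp.inner_apply, mul_comm]

end Norms

/-! ### Accumulated gradients. -/

section Accum

variable {d : ℕ} (g : ℕ → Vec d)

theorem accum_apply (t : ℕ) (i : Fin d) :
    accum g t i = Real.sqrt (∑ k ∈ Finset.range (t + 1), (g k i) ^ 2) := rfl

theorem accum_nonneg (t : ℕ) (i : Fin d) : 0 ≤ accum g t i := Real.sqrt_nonneg _

theorem accum_mono (i : Fin d) : Monotone fun t => accum g t i := fun s t hst =>
  Real.sqrt_le_sqrt (Finset.sum_le_sum_of_subset_of_nonneg
    (Finset.range_mono (by omega)) fun _ _ _ => sq_nonneg _)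

theorem abs_le_accum (t : ℕ) (i : Fin d) : |g t i| ≤ accum g t i := by
  rw [accum_apply, ← Real.sqrt_sq_eq_abs]
  exact Real.sqrt_le_sqrt (Finset.single_le_sum (f := fun k => (g k i) ^ 2)
    (fun _ _ => sq_nonneg _) (Finset.self_mem_range_succ t))

theorem norm_accum_sq (t : ℕ) : ‖accum g t‖ ^ 2 = ∑ k ∈ Finset.range (t + 1), ‖g k‖ ^ 2 := by
  simp only [EuclideanSpace.norm_sq_eq, Real.norm_eq_abs, sq_abs]
  rw [Finset.sum_comm]
  refine Finset.sum_congr rfl fun i _ => ?_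
  rw [accum_apply, Real.sq_sqrt (Finset.sum_nonneg fun _ _ => sq_nonneg _)]

/-- Telescoping: if `B² = A² + g²` with `A, B ≥ 0`, then `g² / B ≤ 2 (B - A)`. -/
theorem sum_sq_div_accum_le (i : Fin d) (n : ℕ) :
    ∑ t ∈ Finset.range n, g t i ^ 2 / accum g t i
      ≤ 2 * Real.sqrt (∑ t ∈ Finset.range n, g t i ^ 2) := by
  induction n with
  | zero => simp
  | succ n ih =>
    rw [Finset.sum_range_succ]
    have hA := Real.sqrt_nonneg (∑ t ∈ Finset.range n, g t i ^ 2)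
    have hA2 := Real.sq_sqrt (Finset.sum_nonneg fun t (_ : t ∈ Finset.range n) => sq_nonneg (g t i))
    have hB2 : accum g n i ^ 2 = ∑ t ∈ Finset.range n, g t i ^ 2 + g n i ^ 2 := by
      rw [accum_apply, Real.sq_sqrt (Finset.sum_nonneg fun _ _ => sq_nonneg _),
        Finset.sum_range_succ]
    rw [← accum_apply]
    set A := Real.sqrt (∑ t ∈ Finset.range n, g t i ^ 2)
    rcases (accum_nonneg g n i).eq_or_lt with h0 | hpos
    · rw [← h0] at hB2 ⊢
      have : A = 0 := by nlinarith [sq_nonneg (g n i)]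
      simp only [div_zero]
      linarith
    · have : g n i ^ 2 / accum g n i ≤ 2 * (accum g n i - A) := by
        rw [div_le_iff₀ hpos]
        nlinarith [sq_nonneg (accum g n i - A)]
      linarith

end Accum

/-! ### Dynamics of the iterates and the deterministic regret. -/

section Dynamics

variable {d : ℕ} (x₀ : Vec d) (ε γ : ℝ) (g : ℕ → Vec d)

theorem iter_succ_apply (t : ℕ) (i : Fin d) : iter x₀ ε γ g (t + 1) i =
    iter x₀ ε γ g t i - step x₀ ε γ g t * ((γ + accum g t i)⁻¹ * g t i) := rfl

theorem step_succ (t : ℕ) : step x₀ ε γ g (t + 1) =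
    max (step x₀ ε γ g t) (‖iter x₀ ε γ g (t + 1) - x₀‖ / Real.sqrt d) := rfl

theorem step_mono : Monotone (step x₀ ε γ g) :=
  monotone_nat_of_le_succ fun t => by rw [step_succ]; exact le_max_left _ _

theorem le_step (t : ℕ) : ε ≤ step x₀ ε γ g t := step_mono x₀ ε γ g t.zero_le

variable {ε γ}

theorem abs_inv_mul_le_one (hγ : 0 ≤ γ) (t : ℕ) (i : Fin d) :
    |(γ + accum g t i)⁻¹ * g t i| ≤ 1 := by
  have hs := accum_nonneg g t i
  rw [abs_mul, abs_inv, abs_of_nonneg (add_nonneg hγ hs)]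
  exact inv_mul_le_one_of_le₀ ((abs_le_accum g t i).trans (by linarith)) (add_nonneg hγ hs)

theorem abs_iter_succ_sub_le (hε : 0 < ε) (hγ : 0 ≤ γ) (t : ℕ) (i : Fin d) :
    |iter x₀ ε γ g (t + 1) i - iter x₀ ε γ g t i| ≤ step x₀ ε γ g t := by
  have hpos : 0 ≤ step x₀ ε γ g t := hε.le.trans (le_step x₀ ε γ g t)
  rw [iter_succ_apply, sub_sub_cancel_left, abs_neg, abs_mul, abs_of_nonneg hpos]
  exact mul_le_of_le_one_right hpos (abs_inv_mul_le_one g hγ t i)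

theorem step_one (hε : 0 < ε) (hγ : 0 ≤ γ) : step x₀ ε γ g 1 = step x₀ ε γ g 0 := by
  rw [step_succ]
  exact max_eq_left (norm_div_sqrt_le (hε.le.trans (le_step x₀ ε γ g 0)) fun i =>
    abs_iter_succ_sub_le x₀ g hε hγ 0 i)

/-- A coordinate moves by at most `η_t`, and `η` grows only to the largest coordinate displacement,
so the common bound at most doubles. This crude bound serves to make the oracle answers integrable.
-/
theorem iter_bounded (hε : 0 < ε) (hγ : 0 ≤ γ) (t : ℕ) :
    step x₀ ε γ g t ≤ ε * 2 ^ t ∧ ∀ i, |iter x₀ ε γ g t i - x₀ i| ≤ ε * 2 ^ t := by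
  induction t with
  | zero => exact ⟨by simp [step, state], fun i => by simp [iter, state, hε.le]⟩
  | succ t ih =>
    have hx : ∀ i, |iter x₀ ε γ g (t + 1) i - x₀ i| ≤ ε * 2 ^ (t + 1) := fun i => by
      have h1 := abs_iter_succ_sub_le x₀ g hε hγ t i
      have h2 := abs_sub_le (iter x₀ ε γ g (t + 1) i) (iter x₀ ε γ g t i) (x₀ i)
      have h3 := ih.2 i
      have h4 := ih.1
      rw [pow_succ]
      linarith
    refine ⟨?_, hx⟩
    rw [step_succ]
    refine max_le (ih.1.trans ?_) (norm_div_sqrt_le (by positivity) hx)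
    rw [pow_succ]
    nlinarith [show 0 < ε * 2 ^ t by positivity]

variable (ε γ) in
/-- The largest coordinate distance to `xs` up to time `τ`. -/
noncomputable abbrev supDist (xs : Vec d) (τ : ℕ) : ℝ :=
  runMax (fun t => supNorm (iter x₀ ε γ g t - xs)) τ

theorem abs_sub_le_supDist (xs : Vec d) {t τ : ℕ} (h : t ≤ τ) (i : Fin d) :
    |iter x₀ ε γ g t i - xs i| ≤ supDist x₀ ε γ g xs τ :=
  (abs_apply_le_supNorm (iter x₀ ε γ g t - xs) i).trans
    (le_runMax (fun t => supNorm (iter x₀ ε γ g t - xs)) h)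

theorem supDist_nonneg (xs : Vec d) (τ : ℕ) : 0 ≤ supDist x₀ ε γ g xs τ :=
  (supNorm_nonneg _).trans (le_runMax (fun t => supNorm (iter x₀ ε γ g t - xs)) τ.zero_le)

/-- Going through `xs`, every coordinate of `x_t - x₀` is at most `2 D_τ`. -/
theorem step_le_max (xs : Vec d) {t τ : ℕ} (h : t ≤ τ) :
    step x₀ ε γ g t ≤ max ε (2 * supDist x₀ ε γ g xs τ) := by
  induction t with
  | zero => exact le_max_left _ _
  | succ t ih =>
    rw [step_succ]
    refine max_le (ih (by omega)) (le_max_of_le_right ?_)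
    refine norm_div_sqrt_le (by linarith [supDist_nonneg (ε := ε) (γ := γ) x₀ g xs τ]) fun i => ?_
    have h1 := abs_sub_le_supDist (ε := ε) (γ := γ) x₀ g xs h i
    have h2 := abs_sub_le_supDist (ε := ε) (γ := γ) x₀ g xs τ.zero_le i
    have h3 := abs_sub_le (iter x₀ ε γ g (t + 1) i) (xs i) (x₀ i)
    rw [abs_sub_comm (xs i)] at h3
    change |iter x₀ ε γ g (t + 1) i - x₀ i| ≤ _
    change |x₀ i - xs i| ≤ _ at h2
    linarith

/-- The regret of one coordinate. -/
theorem sum_coord_le (hε : 0 < ε) (hγ : 0 ≤ γ) (xs : Vec d) (τ : ℕ) (i : Fin d) :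
    ∑ t ∈ Finset.range τ, step x₀ ε γ g t * (g t i * (iter x₀ ε γ g t i - xs i))
      ≤ supDist x₀ ε γ g xs τ ^ 2 * (γ + accum g τ i) / 2
        + step x₀ ε γ g τ ^ 2 * accum g τ i := by
  set D := supDist x₀ ε γ g xs τ with hD
  have hz : ∀ t ≤ τ, (iter x₀ ε γ g t i - xs i) ^ 2 ≤ D ^ 2 := fun t ht =>
    sq_le_sq' (abs_le.1 (abs_sub_le_supDist x₀ g xs ht i)).1
      (abs_le.1 (abs_sub_le_supDist x₀ g xs ht i)).2
  -- Summation by parts as an invariant: raising the weight by `s_{n+1} - s_n` costs at most `D²`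
  -- times that increment.
  have htel : ∀ n ≤ τ, ∑ t ∈ Finset.range n, (γ + accum g t i) *
        ((iter x₀ ε γ g t i - xs i) ^ 2 - (iter x₀ ε γ g (t + 1) i - xs i) ^ 2)
      + (γ + accum g n i) * (iter x₀ ε γ g n i - xs i) ^ 2 ≤ D ^ 2 * (γ + accum g n i) := by
    intro n
    induction n with
    | zero =>
      intro h
      have := mul_le_mul_of_nonneg_left (hz 0 h) (add_nonneg hγ (accum_nonneg g 0 i))
      simpa [mul_comm] using this
    | succ n ih =>
      intro h
      have ih := ih (by omega)
      have hmono : accum g n i ≤ accum g (n + 1) i := accum_mono g i n.le_succ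
      have := mul_le_mul_of_nonneg_left (hz (n + 1) h) (sub_nonneg.2 hmono)
      rw [Finset.sum_range_succ]
      linarith
  -- The regret is weighted by `η_t`, so expanding the square leaves the potential with weight `γ +
  -- s_t`, monotone in `t`, rather than `(γ + s_t) / η_t`.
  have hterm : ∀ t ∈ Finset.range τ,
      step x₀ ε γ g t * (g t i * (iter x₀ ε γ g t i - xs i))
        ≤ (γ + accum g t i) *
          ((iter x₀ ε γ g t i - xs i) ^ 2 - (iter x₀ ε γ g (t + 1) i - xs i) ^ 2) / 2
          + step x₀ ε γ g τ ^ 2 / 2 * (g t i ^ 2 / accum g t i) := by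
    intro t ht
    have hη0 : 0 ≤ step x₀ ε γ g t := hε.le.trans (le_step x₀ ε γ g t)
    have hη : step x₀ ε γ g t ^ 2 ≤ step x₀ ε γ g τ ^ 2 :=
      pow_le_pow_left₀ hη0 (step_mono x₀ ε γ g (Finset.mem_range.1 ht).le) 2
    have hs := accum_nonneg g t i
    rw [iter_succ_apply]
    rcases hs.eq_or_lt with h0 | hpos
    · have hg : g t i = 0 := by simpa [← h0] using abs_le_accum g t i
      simp [hg]
    · have ha : 0 < γ + accum g t i := by linarith
      have h1 : g t i ^ 2 / (γ + accum g t i) ≤ g t i ^ 2 / accum g t i :=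
        div_le_div_of_nonneg_left (sq_nonneg _) hpos (by linarith)
      have h2 := mul_le_mul hη h1 (by positivity) (sq_nonneg _)
      have h3 : (γ + accum g t i) * ((iter x₀ ε γ g t i - xs i) ^ 2 -
          (iter x₀ ε γ g t i - step x₀ ε γ g t * ((γ + accum g t i)⁻¹ * g t i) - xs i) ^ 2) / 2
          = step x₀ ε γ g t * (g t i * (iter x₀ ε γ g t i - xs i))
            - step x₀ ε γ g t ^ 2 * (g t i ^ 2 / (γ + accum g t i)) / 2 := by
        field_simp
        ring
      rw [h3]
      linarith
  refine (Finset.sum_le_sum hterm).trans ?_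
  rw [Finset.sum_add_distrib, ← Finset.sum_div, ← Finset.mul_sum]
  have h1 := htel τ le_rfl
  have h2 := mul_nonneg (add_nonneg hγ (accum_nonneg g τ i)) (sq_nonneg (iter x₀ ε γ g τ i - xs i))
  have h3 : ∑ t ∈ Finset.range τ, g t i ^ 2 / accum g t i ≤ 2 * accum g τ i :=
    (sum_sq_div_accum_le g i τ).trans (mul_le_mul_of_nonneg_left (Real.sqrt_le_sqrt
      (Finset.sum_le_sum_of_subset_of_nonneg (Finset.range_mono τ.le_succ)
        fun _ _ _ => sq_nonneg _)) zero_le_two)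
  have h4 := mul_le_mul_of_nonneg_left h3
    (show 0 ≤ step x₀ ε γ g τ ^ 2 / 2 by positivity)
  linarith

/-- The weighted linearized regret. -/
noncomputable def linRegret (x₀ : Vec d) (ε γ : ℝ) (g : ℕ → Vec d) (xs : Vec d) (τ : ℕ) : ℝ :=
  ∑ t ∈ Finset.range τ, step x₀ ε γ g t * inner ℝ (g t) (iter x₀ ε γ g t - xs)

theorem linRegret_le (hε : 0 < ε) (hγ : 0 ≤ γ) (xs : Vec d) (τ : ℕ) :
    linRegret x₀ ε γ g xs τ ≤
      supDist x₀ ε γ g xs τ ^ 2 * (Real.sqrt d * ‖accum g τ‖ + d * γ) / 2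
        + step x₀ ε γ g τ ^ 2 * (Real.sqrt d * ‖accum g τ‖) := by
  have h1 : linRegret x₀ ε γ g xs τ = ∑ i, ∑ t ∈ Finset.range τ,
      step x₀ ε γ g t * (g t i * (iter x₀ ε γ g t i - xs i)) := by
    rw [Finset.sum_comm]
    simp [linRegret, inner_eq_sum, Finset.mul_sum]
  rw [h1]
  refine (Finset.sum_le_sum fun i _ => sum_coord_le x₀ g hε hγ xs τ i).trans ?_
  rw [Finset.sum_add_distrib, ← Finset.sum_div, ← Finset.mul_sum, ← Finset.mul_sum,
    Finset.sum_add_distrib, Finset.sum_const, Finset.card_univ, Fintype.card_fin, nsmul_eq_mul]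
  have h2 := sum_le_sqrt_mul_norm (accum g τ)
  have h3 := mul_le_mul_of_nonneg_left h2 (sq_nonneg (supDist x₀ ε γ g xs τ))
  have h4 := mul_le_mul_of_nonneg_left h2 (sq_nonneg (step x₀ ε γ g τ))
  linarith

/-- Write `η² = (η / ε) (η ε)` with `η ≤ 2 M` and `ε ≤ M`. The factor `η / ε` is kept because the
choice of `τ` later cancels `η`. -/
theorem linRegret_le_max (hε : 0 < ε) (hγ : 0 ≤ γ) (xs : Vec d) (τ : ℕ) :
    linRegret x₀ ε γ g xs τ ≤ 5 * (step x₀ ε γ g τ / ε) *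
      (max (supDist x₀ ε γ g xs τ) ε ^ 2 * (Real.sqrt d * ‖accum g τ‖ + d * γ)) := by
  refine (linRegret_le x₀ g hε hγ xs τ).trans ?_
  set D := supDist x₀ ε γ g xs τ
  set η := step x₀ ε γ g τ with hη
  set M := max D ε
  set S := Real.sqrt d * ‖accum g τ‖
  have hS : 0 ≤ S := by positivity
  have hdγ : 0 ≤ d * γ := by positivity
  have hD : 0 ≤ D := supDist_nonneg x₀ g xs τ
  have hDM : D ≤ M := le_max_left _ _
  have hεM : ε ≤ M := le_max_right _ _
  have hεη : ε ≤ η := le_step x₀ ε γ g τ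
  have hr : 1 ≤ η / ε := (one_le_div hε).2 hεη
  have hηM : η ≤ 2 * M :=
    (step_le_max x₀ g xs le_rfl).trans (max_le (by linarith) (by linarith))
  have h1 : D ^ 2 * (S + d * γ) ≤ (η / ε) * (M ^ 2 * (S + d * γ)) := by
    refine le_trans ?_ (le_mul_of_one_le_left (by positivity) hr)
    gcongr
  have h2 : η ^ 2 ≤ (η / ε) * (2 * M ^ 2) := by
    have : η ^ 2 = (η / ε) * (η * ε) := by field_simp
    rw [this]
    exact mul_le_mul_of_nonneg_left (by nlinarith) (by linarith)
  have h3 : η ^ 2 * S ≤ (η / ε) * (2 * M ^ 2) * (S + d * γ) :=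
    mul_le_mul h2 (by linarith) hS (by positivity)
  nlinarith [mul_nonneg (zero_le_one.trans hr)
    (mul_nonneg (sq_nonneg M) (add_nonneg hS hdγ))]

/-- At the first nonzero gradient entry of a coordinate, `s = |g|`, so without damping this
coordinate jumps by exactly `η_k ≥ ε`. Both ends of the jump lie within `D_τ` of `xs`. -/
theorem le_two_mul_supDist_of_ne_zero (hε : 0 < ε) (xs : Vec d) {τ t : ℕ} (ht : t < τ) {i : Fin d}
    (hg : g t i ≠ 0) : ε ≤ 2 * supDist x₀ ε 0 g xs τ := by
  classical
  have hex : ∃ t, g t i ≠ 0 := ⟨t, hg⟩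
  set k := Nat.find hex with hk
  have hkt : k ≤ t := Nat.find_le hg
  have hgk : g k i ≠ 0 := Nat.find_spec hex
  have hzero : ∀ m < k, g m i = 0 := fun m hm => not_not.1 (Nat.find_min hex hm)
  have hs : accum g k i = |g k i| := by
    rw [accum_apply, Finset.sum_range_succ, Finset.sum_eq_zero, zero_add, Real.sqrt_sq_eq_abs]
    intro m hm
    rw [hzero m (Finset.mem_range.1 hm)]; simp
  have hmove : |iter x₀ ε 0 g (k + 1) i - iter x₀ ε 0 g k i| = step x₀ ε 0 g k := by
    rw [iter_succ_apply, sub_sub_cancel_left, abs_neg, abs_mul, abs_mul, zero_add, hs, abs_inv,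
      abs_abs, inv_mul_cancel₀ (abs_ne_zero.2 hgk), mul_one,
      abs_of_nonneg (hε.le.trans (le_step x₀ ε 0 g k))]
  have h1 := abs_sub_le_supDist (ε := ε) (γ := 0) x₀ g xs (show k + 1 ≤ τ by omega) i
  have h2 := abs_sub_le_supDist (ε := ε) (γ := 0) x₀ g xs (show k ≤ τ by omega) i
  have h3 := abs_sub_le (iter x₀ ε 0 g (k + 1) i) (xs i) (iter x₀ ε 0 g k i)
  rw [abs_sub_comm (xs i)] at h3
  have h4 := le_step x₀ ε 0 g k
  linarith

theorem linRegret_le_undamped (hε : 0 < ε) (xs : Vec d) (τ : ℕ) :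
    linRegret x₀ ε 0 g xs τ ≤ 5 * (step x₀ ε 0 g τ / ε) *
      (supDist x₀ ε 0 g xs τ ^ 2 * Real.sqrt d * ‖accum g τ‖) := by
  have hεη : ε ≤ step x₀ ε 0 g τ := le_step x₀ ε 0 g τ
  have hr : 1 ≤ step x₀ ε 0 g τ / ε := (one_le_div hε).2 hεη
  by_cases h : ∃ t < τ, ∃ i, g t i ≠ 0
  · obtain ⟨t, ht, i, hg⟩ := h
    have hεD := le_two_mul_supDist_of_ne_zero x₀ g hε xs ht hg
    have hηD : step x₀ ε 0 g τ ≤ 2 * supDist x₀ ε 0 g xs τ :=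
      (step_le_max x₀ g xs le_rfl).trans (max_le hεD le_rfl)
    have hreg := linRegret_le x₀ g hε le_rfl xs τ
    rw [mul_zero, add_zero] at hreg
    refine hreg.trans ?_
    rw [mul_assoc (supDist x₀ ε 0 g xs τ ^ 2)]
    set D := supDist x₀ ε 0 g xs τ
    set η := step x₀ ε 0 g τ
    set S := Real.sqrt d * ‖accum g τ‖
    have hS : 0 ≤ S := by positivity
    have h1 : D ^ 2 * S ≤ (η / ε) * (D ^ 2 * S) := le_mul_of_one_le_left (by positivity) hr
    have h2 : η ^ 2 ≤ (η / ε) * (4 * D ^ 2) := by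
      have : η ^ 2 = (η / ε) * (η * ε) := by field_simp
      rw [this]
      exact mul_le_mul_of_nonneg_left (by nlinarith) (by linarith)
    have h3 := mul_le_mul_of_nonneg_right h2 hS
    nlinarith [mul_nonneg (sq_nonneg D) hS]
  -- If every gradient before `τ` vanishes, `D_τ` need not dominate `ε`, but the regret is zero.
  · push Not at h
    have h0 : linRegret x₀ ε 0 g xs τ = 0 := by
      refine Finset.sum_eq_zero fun t ht => ?_
      rw [inner_eq_sum, Finset.sum_eq_zero, mul_zero]
      intro i _
      rw [h t (Finset.mem_range.1 ht) i, zero_mul]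
    rw [h0]
    positivity

end Dynamics

end AdaGradPP

namespace AdaGradPP

/-! ### Dyadic scales, and from noise bounds to the optimality gap. -/

section Gap

theorem one_le_log_six_mul {τ : ℕ} (hτ : 1 ≤ τ) : 1 ≤ Real.log (6 * τ) := by
  rw [Real.le_log_iff_exp_le (by positivity)]
  have h : (1 : ℝ) ≤ τ := Nat.one_le_cast.2 hτ
  have := Real.exp_one_lt_d9
  linarith

theorem one_le_theta {τ : ℕ} (hτ : 1 ≤ τ) {δ : ℝ} (hδ : 0 < δ) (hδ1 : δ < 1) : 1 ≤ theta τ δ := by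
  have h := one_le_log_six_mul hτ
  unfold theta
  rw [Real.le_log_iff_exp_le (by positivity), le_div_iff₀ hδ]
  have := Real.exp_one_lt_d9
  nlinarith [Real.exp_pos 1]

/-- The confidence level `log (1 / δ_j)`, `δ_j = δ / (2 (j + 1) (j + 2))`, of the `j`-th scale. -/
noncomputable def scaleLevel (δ : ℝ) (j : ℕ) : ℝ :=
  Real.log (2 * ((j + 1) * (j + 2)) / δ)

/-- A difference, so that the union bound over the scales telescopes. -/
theorem exp_neg_scaleLevel {δ : ℝ} (hδ : 0 < δ) (j : ℕ) :
    Real.exp (-scaleLevel δ j) = δ / 2 * (1 / (j + 1) - 1 / ((j + 1 : ℕ) + 1)) := by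
  rw [scaleLevel, Real.exp_neg, Real.exp_log (by positivity)]
  push_cast
  field_simp
  ring

theorem sum_exp_neg_scaleLevel_le {δ : ℝ} (hδ : 0 < δ) (n : ℕ) :
    ∑ j ∈ Finset.range n, 2 * Real.exp (-scaleLevel δ j) ≤ δ := by
  simp_rw [exp_neg_scaleLevel hδ]
  rw [← Finset.mul_sum, ← Finset.mul_sum,
    Finset.sum_range_sub' (fun j : ℕ => 1 / ((j : ℝ) + 1)) n]
  have : (0 : ℝ) ≤ 1 / ((n : ℝ) + 1) := by positivity
  rw [Nat.cast_zero, zero_add, div_one]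
  nlinarith

/-- The `j`-th scale. -/
noncomputable def scale (L : ℝ) (j : ℕ) : ℝ := ((2 : ℝ) ^ j)⁻¹ / (2 * L)

theorem scale_pos {L : ℝ} (hL : 0 < L) (j : ℕ) : 0 < scale L j := by
  unfold scale; positivity

theorem scale_mul_le {L : ℝ} (hL : 0 < L) (j : ℕ) : scale L j * L ≤ 1 / 2 := by
  have h : ((2 : ℝ) ^ j)⁻¹ ≤ 1 := inv_le_one_of_one_le₀ (one_le_pow₀ one_le_two)
  have : scale L j * L = ((2 : ℝ) ^ j)⁻¹ / 2 := by unfold scale; field_simp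
  rw [this]; linarith

/-- Among the dyadic scales, one is nearly optimal. -/
theorem exists_scale {τ : ℕ} (hτ : 1 ≤ τ) {δ L V : ℝ} (hδ : 0 < δ) (hδ1 : δ < 1) (hL : 0 < L)
    (hVL : V ≤ (τ + 1) * L ^ 2) :
    ∃ j < τ + 2, scale L j * Real.sqrt V ≤ Real.sqrt (theta τ δ) ∧
      Real.sqrt (theta τ δ) ≤ scale L j * (2 * L * Real.sqrt (theta τ δ) + 2 * Real.sqrt V) ∧
      scaleLevel δ j ≤ 2 * theta τ δ := by
  classical
  have hlog := one_le_log_six_mul hτ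
  set q := Real.sqrt (theta τ δ) with hq
  have hq1 : 1 ≤ q := Real.one_le_sqrt.2 (one_le_theta hτ hδ hδ1)
  set v := Real.sqrt V with hv
  have hv0 : 0 ≤ v := Real.sqrt_nonneg _
  have hτ1 : (1 : ℝ) ≤ τ := Nat.one_le_cast.2 hτ
  have hvL : v ^ 2 ≤ (τ + 1) * L ^ 2 := by
    rcases le_total 0 V with h | h
    · rwa [hv, Real.sq_sqrt h]
    · rw [hv, Real.sqrt_eq_zero_of_nonpos h, zero_pow two_ne_zero]; positivity
  -- The least such `j` is the first scale with `scale L j * √V ≤ √θ`; minimality gives the reverse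
  -- inequality up to a factor two.
  have hex : ∃ j : ℕ, v ≤ 2 * L * q * 2 ^ j := by
    obtain ⟨j, hj⟩ := pow_unbounded_of_one_lt (v / (2 * L * q)) (one_lt_two (α := ℝ))
    refine ⟨j, ?_⟩
    rw [div_lt_iff₀ (by positivity)] at hj
    linarith
  -- The argument of `scaleLevel` is quadratic in `j ≤ log (6 τ)`, so the square of the argument of
  -- `θ` dominates it; this is the factor `2`.
  have hlevel : ∀ j : ℕ, (j : ℝ) ≤ Real.log (6 * τ) → scaleLevel δ j ≤ 2 * theta τ δ := by
    intro j hj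
    rw [scaleLevel, theta, show (2 : ℝ) = ((2 : ℕ) : ℝ) by norm_num, ← Real.log_pow]
    refine Real.log_le_log (by positivity) ?_
    rw [div_pow, div_le_div_iff₀ hδ (by positivity)]
    have hj0 : (0 : ℝ) ≤ j := Nat.cast_nonneg j
    have h1 : ((j : ℝ) + 1) * (j + 2) ≤ 6 * Real.log (6 * τ) ^ 2 := by nlinarith
    have h2 : δ ^ 2 ≤ δ := by nlinarith
    push_cast
    calc (2 : ℝ) * ((j + 1) * (j + 2)) * δ ^ 2
        ≤ 2 * (6 * Real.log (6 * τ) ^ 2) * δ := by gcongr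
      _ ≤ (60 * Real.log (6 * τ)) ^ 2 * δ := by
        refine mul_le_mul_of_nonneg_right ?_ hδ.le
        nlinarith [sq_nonneg (Real.log (6 * τ))]
  set j := Nat.find hex with hj
  have hjs : v ≤ 2 * L * q * 2 ^ j := Nat.find_spec hex
  have hfirst : scale L j * v ≤ q := by
    have : scale L j * (2 * L * q * 2 ^ j) = q := by unfold scale; field_simp
    rw [← this]
    exact mul_le_mul_of_nonneg_left hjs (scale_pos hL j).le
  rcases Nat.eq_zero_or_pos j with h0 | hpos
  · refine ⟨j, by omega, hfirst, ?_, hlevel j ?_⟩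
    · have : scale L j * (2 * L * q + 2 * v) = q + v / L := by
        rw [h0]; unfold scale; field_simp
      rw [this]
      have : 0 ≤ v / L := by positivity
      linarith
    · rw [h0, Nat.cast_zero]; linarith
  · obtain ⟨m, hm⟩ : ∃ m, j = m + 1 := ⟨j - 1, by omega⟩
    have hmn : 2 * L * q * 2 ^ m < v := not_le.1 (Nat.find_min hex (show m < Nat.find hex by omega))
    -- Failure at `m` together with `V ≤ (τ + 1) L²` forces `4 ^ (m + 1) < τ + 1`: only
    -- logarithmically many scales are needed.
    have h4 : (4 : ℝ) ^ m * 2 ≤ τ := by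
      have h1 : (2 * L * 2 ^ m) ^ 2 < v ^ 2 := by
        refine pow_lt_pow_left₀ (lt_of_le_of_lt ?_ hmn) (by positivity) two_ne_zero
        have : 0 ≤ 2 * L * 2 ^ m := by positivity
        nlinarith
      have h2 : (2 * L * 2 ^ m) ^ 2 = (4 * 4 ^ m) * L ^ 2 := by
        rw [mul_pow, mul_pow, ← pow_mul, mul_comm m 2, pow_mul]; norm_num; ring
      rw [h2] at h1
      have h3 : (4 : ℝ) * 4 ^ m < τ + 1 :=
        lt_of_mul_lt_mul_right (h1.trans_le hvL) (by positivity)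
      linarith
    have hmτ : m < τ := by
      have h5 : m < 4 ^ m := Nat.lt_pow_self (by norm_num)
      have h6 : 4 ^ m * 2 ≤ τ := by exact_mod_cast h4
      omega
    refine ⟨j, by omega, hfirst, ?_, hlevel j ?_⟩
    · have h1 : scale L j * (2 * (2 * L * q * 2 ^ m)) = q := by
        rw [hm]; unfold scale; rw [pow_succ]; field_simp
      have h2 := scale_pos hL j
      have h3 : 0 ≤ 2 * L * q := by positivity
      calc q = scale L j * (2 * (2 * L * q * 2 ^ m)) := h1.symm
        _ ≤ _ := mul_le_mul_of_nonneg_left (by linarith) h2.le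
    · rw [hm, Real.le_log_iff_exp_le (by positivity)]
      push_cast
      rw [Real.exp_add]
      have he := Real.exp_one_lt_d9
      have h7 : Real.exp m ≤ 4 ^ m := by
        rw [← mul_one (m : ℝ), Real.exp_nat_mul]
        exact pow_le_pow_left₀ (Real.exp_nonneg _) (by linarith) m
      have h8 : Real.exp m * Real.exp 1 ≤ 4 ^ m * 3 :=
        mul_le_mul h7 (by linarith) (Real.exp_nonneg _) (by positivity)
      linarith

/-- At the scale `s` of `exists_scale`, `s V ≤ √(θ V)` and `θ / s ≤ 2 L θ + 2 √(θ V)`. Dividing the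
hypothesis by `s` gives `6 √(θ V) + 4 L θ`, hence the constant `10`. -/
theorem abs_le_of_scales {τ : ℕ} (hτ : 1 ≤ τ) {δ L V S : ℝ} (hδ : 0 < δ) (hδ1 : δ < 1) (hL : 0 < L)
    (hV : 0 ≤ V) (hVL : V ≤ (τ + 1) * L ^ 2)
    (h : ∀ j < τ + 2, scale L j * |S| ≤ 2 * scale L j ^ 2 * V + scaleLevel δ j) :
    |S| ≤ 10 * Real.sqrt (theta τ δ * V + L ^ 2 * theta τ δ ^ 2) := by
  obtain ⟨j, hj, h1, h2, h3⟩ := exists_scale hτ hδ hδ1 hL hVL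
  have hθ := one_le_theta hτ hδ hδ1
  have h := h j hj
  have hs := scale_pos hL j
  set s := scale L j
  set θ := theta τ δ
  have hq : Real.sqrt θ ^ 2 = θ := Real.sq_sqrt (by linarith)
  have hv : Real.sqrt V ^ 2 = V := Real.sq_sqrt hV
  have hR1 : Real.sqrt θ * Real.sqrt V ≤ Real.sqrt (θ * V + L ^ 2 * θ ^ 2) := by
    rw [← Real.sqrt_mul (by linarith)]
    exact Real.sqrt_le_sqrt (by nlinarith [sq_nonneg (L * θ)])
  have hR2 : L * θ ≤ Real.sqrt (θ * V + L ^ 2 * θ ^ 2) :=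
    Real.le_sqrt_of_sq_le (by nlinarith [mul_nonneg (zero_le_one.trans hθ) hV])
  set q := Real.sqrt θ
  set v := Real.sqrt V
  have hq0 : 0 ≤ q := Real.sqrt_nonneg _
  have hv0 : 0 ≤ v := Real.sqrt_nonneg _
  have h4 : s * |S| ≤ s * (6 * (q * v) + 4 * (L * θ)) := by
    have e1 : s ^ 2 * V ≤ s * (q * v) := by
      rw [← hv]
      nlinarith [mul_le_mul_of_nonneg_left h1 (mul_nonneg hs.le hv0)]
    have e2 : θ ≤ s * (2 * (L * θ) + 2 * (q * v)) := by
      calc θ = q * q := by rw [← hq]; ring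
        _ ≤ q * (s * (2 * L * q + 2 * v)) := mul_le_mul_of_nonneg_left h2 hq0
        _ = s * (2 * (L * q ^ 2) + 2 * (q * v)) := by ring
        _ = _ := by rw [hq]
    linarith
  have h5 := le_of_mul_le_mul_left h4 hs
  linarith

variable {d : ℕ} (x₀ : Vec d) (ε γ : ℝ) (g : ℕ → Vec d) (xs : Vec d)

/-- The largest Euclidean distance to `xs` up to time `τ`. -/
noncomputable abbrev euclDist (τ : ℕ) : ℝ := runMax (fun t => ‖iter x₀ ε γ g t - xs‖) τ

/-- The displacement from `xs`, scaled into the unit ball by the running maximum. -/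
noncomputable def unitDisp (t : ℕ) : Vec d :=
  (euclDist x₀ ε γ g xs t)⁻¹ • (iter x₀ ε γ g t - xs)

theorem euclDist_nonneg (t : ℕ) : 0 ≤ euclDist x₀ ε γ g xs t :=
  (norm_nonneg _).trans (le_runMax (fun t => ‖iter x₀ ε γ g t - xs‖) t.zero_le)

theorem norm_unitDisp_le (t : ℕ) : ‖unitDisp x₀ ε γ g xs t‖ ≤ 1 := by
  have h := euclDist_nonneg x₀ ε γ g xs t
  rw [unitDisp, norm_smul, norm_inv, Real.norm_of_nonneg h]
  exact inv_mul_le_one_of_le₀ (le_runMax (fun t => ‖iter x₀ ε γ g t - xs‖) le_rfl) h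

theorem euclDist_smul_unitDisp (t : ℕ) :
    euclDist x₀ ε γ g xs t • unitDisp x₀ ε γ g xs t = iter x₀ ε γ g t - xs := by
  by_cases h : euclDist x₀ ε γ g xs t = 0
  · have h1 : ‖iter x₀ ε γ g t - xs‖ ≤ euclDist x₀ ε γ g xs t :=
      le_runMax (fun t => ‖iter x₀ ε γ g t - xs‖) le_rfl
    rw [h] at h1
    rw [h, zero_smul, norm_le_zero_iff.1 h1]
  · rw [unitDisp, smul_inv_smul₀ h]

variable {x₀ ε γ g xs}

/-- The weights `η_t D̄_t` are random with no useful a priori bound, but they are nondecreasing, so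
Abel summation pays only for the last one. -/
theorem abs_noise_le (hε : 0 < ε) {G : ℕ → Vec d} {τ : ℕ} {B : ℝ}
    (hB : ∀ k ≤ τ,
      |∑ i ∈ Finset.range k, inner ℝ (unitDisp x₀ ε γ g xs i) (g i - G i)| ≤ B) :
    |∑ t ∈ Finset.range τ, step x₀ ε γ g t * inner ℝ (g t - G t) (iter x₀ ε γ g t - xs)|
      ≤ 2 * (step x₀ ε γ g τ * euclDist x₀ ε γ g xs τ) * B := by
  have hpos : ∀ t, 0 ≤ step x₀ ε γ g t := fun t => hε.le.trans (le_step x₀ ε γ g t)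
  have hy : Monotone fun t => step x₀ ε γ g t * euclDist x₀ ε γ g xs t := fun s t hst =>
    mul_le_mul (step_mono x₀ ε γ g hst) (runMax_mono _ hst) (euclDist_nonneg x₀ ε γ g xs s) (hpos t)
  refine le_trans (le_of_eq ?_) (abs_sum_mul_le_of_monotone hy
    (mul_nonneg (hpos 0) (euclDist_nonneg x₀ ε γ g xs 0)) hB)
  congr 1
  refine Finset.sum_congr rfl fun t _ => ?_
  rw [← euclDist_smul_unitDisp, real_inner_smul_right, real_inner_comm, mul_assoc]

theorem weightedAvg_gap_mul_le (hε : 0 < ε) {f : Vec d → ℝ} (hf : ConvexOn ℝ Set.univ f)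
    {G : ℕ → Vec d} (hG : ∀ t, IsSubgradientAt f (iter x₀ ε γ g t) (G t)) {τ : ℕ} (hτ : 1 ≤ τ) :
    (∑ t ∈ Finset.range τ, step x₀ ε γ g t) *
        (f (weightedAvg (step x₀ ε γ g) (iter x₀ ε γ g) τ) - f xs)
      ≤ ∑ t ∈ Finset.range τ, step x₀ ε γ g t * inner ℝ (G t) (iter x₀ ε γ g t - xs) := by
  have hpos : ∀ t, 0 < step x₀ ε γ g t := fun t => hε.trans_le (le_step x₀ ε γ g t)
  set H := ∑ t ∈ Finset.range τ, step x₀ ε γ g t with hH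
  have hHpos : 0 < H := Finset.sum_pos (fun t _ => hpos t) ⟨0, Finset.mem_range.2 hτ⟩
  have hJ : f (weightedAvg (step x₀ ε γ g) (iter x₀ ε γ g) τ)
      ≤ ∑ t ∈ Finset.range τ, (H⁻¹ * step x₀ ε γ g t) * f (iter x₀ ε γ g t) := by
    have := hf.map_sum_le (t := Finset.range τ) (w := fun t => H⁻¹ * step x₀ ε γ g t)
      (p := iter x₀ ε γ g) (fun t _ => mul_nonneg (inv_nonneg.2 hHpos.le) (hpos t).le)
      (by rw [← Finset.mul_sum, inv_mul_cancel₀ hHpos.ne']) (fun _ _ => Set.mem_univ _)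
    simpa [weightedAvg, Finset.smul_sum, smul_smul, ← hH] using this
  have h1 : H * f (weightedAvg (step x₀ ε γ g) (iter x₀ ε γ g) τ)
      ≤ ∑ t ∈ Finset.range τ, step x₀ ε γ g t * f (iter x₀ ε γ g t) := by
    refine (mul_le_mul_of_nonneg_left hJ hHpos.le).trans (le_of_eq ?_)
    rw [Finset.mul_sum]
    refine Finset.sum_congr rfl fun t _ => ?_
    field_simp
  have h2 : ∑ t ∈ Finset.range τ, step x₀ ε γ g t * f (iter x₀ ε γ g t) ≤
      ∑ t ∈ Finset.range τ, step x₀ ε γ g t * inner ℝ (G t) (iter x₀ ε γ g t - xs) + H * f xs := by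
    rw [hH, Finset.sum_mul, ← Finset.sum_add_distrib]
    refine Finset.sum_le_sum fun t _ => ?_
    have h := hG t xs
    rw [← neg_sub, inner_neg_right] at h
    rw [← mul_add]
    exact mul_le_mul_of_nonneg_left (by linarith) (hpos t).le
  linarith

theorem gapBound_of_noise_bound (hε : 0 < ε) (hγ : 0 ≤ γ) {f : Vec d → ℝ}
    (hf : ConvexOn ℝ Set.univ f) {G : ℕ → Vec d}
    (hG : ∀ t, IsSubgradientAt f (iter x₀ ε γ g t) (G t)) {T : ℕ} (hT : 1 ≤ T) {δ L : ℝ}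
    (hnoise : ∀ τ ≤ T, 1 ≤ τ → ∀ k ≤ τ,
      |∑ i ∈ Finset.range k, inner ℝ (unitDisp x₀ ε γ g xs i) (g i - G i)|
        ≤ 10 * Real.sqrt (theta τ δ * ‖accum g τ‖ ^ 2 + L ^ 2 * theta τ δ ^ 2)) :
    GapBound 40 f x₀ ε γ xs δ L T g := by
  intro τ hbest
  have h0 : step x₀ ε γ g 0 = ε := rfl
  have h0pos : 0 < step x₀ ε γ g 0 := hε
  have hτ := hbest.one_le h0pos (step_one x₀ g hε hγ) hT
  have hratio := hbest.le_two_mul (step_mono x₀ ε γ g) h0pos (step_one x₀ g hε hγ) hT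
  have hgap := weightedAvg_gap_mul_le (xs := xs) hε hf hG hτ
  have hN := abs_le.1 (abs_noise_le hε (hnoise τ hbest.1 hτ))
  set R := Real.sqrt (theta τ δ * ‖accum g τ‖ ^ 2 + L ^ 2 * theta τ δ ^ 2) with hR
  have hR0 : 0 ≤ R := Real.sqrt_nonneg _
  have hsplit : ∑ t ∈ Finset.range τ, step x₀ ε γ g t * inner ℝ (G t) (iter x₀ ε γ g t - xs)
      = linRegret x₀ ε γ g xs τ
        - ∑ t ∈ Finset.range τ, step x₀ ε γ g t * inner ℝ (g t - G t) (iter x₀ ε γ g t - xs) := by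
    rw [linRegret, ← Finset.sum_sub_distrib]
    refine Finset.sum_congr rfl fun t _ => ?_
    rw [inner_sub_left]; ring
  have hημ : 0 < step x₀ ε γ g τ := hε.trans_le (le_step x₀ ε γ g τ)
  have hE : 0 ≤ euclDist x₀ ε γ g xs τ := euclDist_nonneg x₀ ε γ g xs τ
  have hT0 : (0 : ℝ) < T := Nat.cast_pos.2 hT
  rw [← Finset.sum_div, h0] at hratio
  have hHpos : 0 < ∑ t ∈ Finset.range τ, step x₀ ε γ g t :=
    Finset.sum_pos (fun t _ => hε.trans_le (le_step x₀ ε γ g t)) ⟨0, Finset.mem_range.2 hτ⟩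
  have main : ∀ W : ℝ, 0 ≤ W → linRegret x₀ ε γ g xs τ ≤ 5 * (step x₀ ε γ g τ / ε) * W →
      f (weightedAvg (step x₀ ε γ g) (iter x₀ ε γ g) τ) ≤ f xs + 40 *
        rate (step x₀ ε γ g) (iter x₀ ε γ g) (accum g) xs δ L T τ W := by
    intro W hW hreg
    unfold rate
    rw [h0, ← hR]
    set H := ∑ t ∈ Finset.range τ, step x₀ ε γ g t
    set η := step x₀ ε γ g τ
    set E := euclDist x₀ ε γ g xs τ
    set Λ := logPlus (step x₀ ε γ g T / ε)
    set Δ := f (weightedAvg (step x₀ ε γ g) (iter x₀ ε γ g) τ) - f xs with hΔ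
    set Q := W + E * ε * R with hQ
    have hQ0 : 0 ≤ Q := by positivity
    -- `20 = 2 · 10`: Abel summation times the noise constant. The regret needs only `5`.
    have h1 : H * Δ ≤ 20 * (η / ε) * Q := by
      have e1 : 2 * (η * E) * (10 * R) = 20 * (η / ε) * (E * ε * R) := by
        field_simp; ring
      have e2 : 0 ≤ (η / ε) * W := by positivity
      rw [hQ]
      linarith
    -- The best-time inequality, cleared of the denominator `η`; it exchanges `η / H` for `2 Λ / T`
    -- and doubles the constant to `40`.
    have h2 : T * η ≤ 2 * H * Λ := by
      have : T * η ≤ 2 * (H / η) * Λ * η := mul_le_mul_of_nonneg_right hratio hημ.le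
      calc T * η ≤ 2 * (H / η) * Λ * η := this
        _ = _ := by field_simp
    have h3 : Δ ≤ 20 * (η / ε) * Q / H := by
      rw [le_div_iff₀ hHpos]; linarith
    have h4 : 20 * (η / ε) * Q / H ≤ 40 * (Q / (T * ε) * Λ) := by
      rw [div_le_iff₀ hHpos]
      have : 20 * (η / ε) * Q = (T * η) * (20 * Q / (T * ε)) := by field_simp
      rw [this]
      refine (mul_le_mul_of_nonneg_right h2 (by positivity)).trans (le_of_eq ?_)
      ring
    have h5 : Δ ≤ 40 * (Q / (T * ε) * Λ) := h3.trans h4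
    linarith
  refine ⟨fun h => ?_, main _ ?_ (linRegret_le_max x₀ g hε hγ xs τ)⟩
  · subst h
    refine main _ ?_ (linRegret_le_undamped x₀ g hε xs τ)
    positivity
  · positivity

end Gap

end AdaGradPP

namespace AdaGradPP

/-! ### Predictability of the iterates. -/

section Measurability

variable {d : ℕ} {α : Type*} [MeasurableSpace α] {x₀ : Vec d} {ε γ : ℝ} {g : ℕ → α → Vec d}

/-- The σ-algebra is generic so that it can be taken to be `ℱ t`; using only the answers before `t`
then yields predictability. -/
theorem measurable_iter_step (t : ℕ) (hg : ∀ k < t, Measurable (g k)) :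
    Measurable (fun ω => iter x₀ ε γ (fun k => g k ω) t) ∧
      Measurable (fun ω => step x₀ ε γ (fun k => g k ω) t) := by
  induction t with
  | zero => exact ⟨measurable_const, measurable_const⟩
  | succ t ih =>
    obtain ⟨hx, hη⟩ := ih fun k hk => hg k (by omega)
    have hcoord : ∀ (i : Fin d) {φ : α → Vec d}, Measurable φ → Measurable fun ω => φ ω i :=
      fun i φ hφ => (EuclideanSpace.proj (𝕜 := ℝ) i).continuous.measurable.comp hφ
    have hacc : ∀ i : Fin d, Measurable fun ω => accum (fun k => g k ω) t i := fun i =>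
      Real.continuous_sqrt.measurable.comp <| Finset.measurable_fun_sum _ fun k hk =>
        (hcoord i (hg k (Finset.mem_range.1 hk))).pow_const 2
    have hx' : Measurable fun ω => iter x₀ ε γ (fun k => g k ω) (t + 1) := by
      refine (PiLp.continuous_toLp 2 _).measurable.comp (measurable_pi_lambda _ fun i => ?_)
      exact (hcoord i hx).sub
        (hη.mul (((hacc i).const_add γ).inv.mul (hcoord i (hg t t.lt_succ_self))))
    refine ⟨hx', ?_⟩
    simp only [step_succ]
    exact hη.max ((hx'.sub_const x₀).norm.div_const _)

theorem measurable_unitDisp (xs : Vec d) (t : ℕ) (hg : ∀ k < t, Measurable (g k)) :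
    Measurable fun ω => unitDisp x₀ ε γ (fun k => g k ω) xs t := by
  have hx : ∀ k ≤ t, Measurable fun ω => iter x₀ ε γ (fun k => g k ω) k := fun k hk =>
    (measurable_iter_step k fun j hj => hg j (by omega)).1
  have hm : Measurable fun ω => euclDist x₀ ε γ (fun k => g k ω) xs t :=
    Finset.measurable_range_sup'' fun k hk => ((hx k hk).sub_const xs).norm
  exact hm.inv.smul ((hx t le_rfl).sub_const xs)

end Measurability

/-! ### Deviation events of the oracle noise. -/

section Noise

variable {d : ℕ} {Ω : Type*} {mΩ : MeasurableSpace Ω} {μ : Measure Ω} {ℱ : Filtration ℕ mΩ}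
  {f l : Vec d → ℝ} {x₀ : Vec d} {ε γ : ℝ} {g : ℕ → Ω → Vec d}

/-- The iterates range over a deterministic bounded set, hence so do the oracle answers. -/
theorem integrable_answer [IsFiniteMeasure μ] (hl : Continuous l) (hε : 0 < ε) (hγ : 0 ≤ γ)
    (hg : ∀ t, StronglyMeasurable[ℱ (t + 1)] (g t))
    (hb : ∀ t, ∀ᵐ ω ∂μ, ‖g t ω‖ ≤ l (iter x₀ ε γ (fun k => g k ω) t)) (t : ℕ) :
    Integrable (g t) μ := by
  obtain ⟨M, hM⟩ := ((isCompact_closedBall x₀ (Real.sqrt d * (ε * 2 ^ t))).image hl).bddAbove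
  refine Integrable.of_bound ((hg t).mono (ℱ.le _)).aestronglyMeasurable M ?_
  filter_upwards [hb t] with ω hω
  refine hω.trans (hM (Set.mem_image_of_mem _ ?_))
  rw [mem_closedBall_iff_norm]
  exact norm_le_sqrt_mul (by positivity) (iter_bounded x₀ (fun k => g k ω) hε hγ t).2

/-- The normalized displacement, scaled by `c` and discarded where `l` exceeds `L`. -/
noncomputable def truncDisp (l : Vec d → ℝ) (x₀ : Vec d) (ε γ : ℝ) (xs : Vec d) (L c : ℝ)
    (g : ℕ → Vec d) (t : ℕ) : Vec d :=
  open Classical in if l (iter x₀ ε γ g t) ≤ L then c • unitDisp x₀ ε γ g xs t else 0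

theorem norm_truncDisp_le (xs : Vec d) (L c : ℝ) (g : ℕ → Vec d) (t : ℕ) :
    ‖truncDisp l x₀ ε γ xs L c g t‖ ≤ |c| := by
  unfold truncDisp
  split_ifs
  · rw [norm_smul, Real.norm_eq_abs]
    exact mul_le_of_le_one_right (abs_nonneg c) (norm_unitDisp_le x₀ ε γ g xs t)
  · simp

/-- The deviation of the noise along `truncDisp` reaches the level `b` by time `T`. -/
def deviationEvent (μ : Measure Ω) (ℱ : Filtration ℕ mΩ) (l : Vec d → ℝ) (x₀ : Vec d) (ε γ : ℝ)
    (xs : Vec d) (L : ℝ) (T : ℕ) (g : ℕ → Ω → Vec d) (c b : ℝ) : Set Ω :=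
  {ω | ∃ k ≤ T, b ≤ ∑ i ∈ Finset.range k,
    (inner ℝ (truncDisp l x₀ ε γ xs L c (fun k => g k ω) i) (g i ω - (μ[g i | ℱ i]) ω)
      - 2 * inner ℝ (truncDisp l x₀ ε γ xs L c (fun k => g k ω) i) (g i ω) ^ 2)}

/-- The truncation depends on `x_i` alone, so it is predictable, and it makes the increments at most
`|c| L ≤ 1 / 2`. Concentration thus applies without conditioning on `l ≤ L`. -/
theorem measureReal_deviationEvent_le [IsProbabilityMeasure μ] (hl : Continuous l) (hε : 0 < ε)
    (hγ : 0 ≤ γ) (hg : ∀ t, StronglyMeasurable[ℱ (t + 1)] (g t))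
    (hb : ∀ t, ∀ᵐ ω ∂μ, ‖g t ω‖ ≤ l (iter x₀ ε γ (fun k => g k ω) t)) (xs : Vec d) {L c : ℝ}
    (hc : |c| * L ≤ 1 / 2) (T : ℕ) (b : ℝ) :
    μ.real (deviationEvent μ ℱ l x₀ ε γ xs L T g c b) ≤ Real.exp (-b) := by
  have hgm : ∀ t, ∀ k < t, Measurable[ℱ t] (g k) := fun t k hk =>
    ((hg k).mono (ℱ.mono hk)).measurable
  refine measureReal_exists_le_sum_inner_le_exp hg (integrable_answer hl hε hγ hg hb)
    (h := fun i ω => truncDisp l x₀ ε γ xs L c (fun k => g k ω) i) (fun i => ?_)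
    (fun i ω => norm_truncDisp_le xs L c _ i) (fun i => ?_) b T
  · have hx : Measurable[ℱ i] fun ω => iter x₀ ε γ (fun k => g k ω) i :=
      (@measurable_iter_step d Ω (ℱ i) x₀ ε γ g i (hgm i)).1
    have hu : Measurable[ℱ i] fun ω => unitDisp x₀ ε γ (fun k => g k ω) xs i :=
      @measurable_unitDisp d Ω (ℱ i) x₀ ε γ g xs i (hgm i)
    have hms : MeasurableSet[ℱ i] {ω | l (iter x₀ ε γ (fun k => g k ω) i) ≤ L} :=
      (hl.measurable.comp hx) measurableSet_Iic
    exact (Measurable.ite hms (hu.const_smul c) measurable_const).stronglyMeasurable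
  · filter_upwards [hb i] with ω hω
    by_cases h : l (iter x₀ ε γ (fun k => g k ω) i) ≤ L
    · refine (abs_real_inner_le_norm _ _).trans (le_trans ?_ hc)
      exact mul_le_mul (norm_truncDisp_le xs L c _ i) (hω.trans h) (norm_nonneg _) (abs_nonneg c)
    · simp [truncDisp, h]

/-- While `l ≤ L` the truncation is inactive, and the compensator is at most `2 c² ‖s_τ‖²` because
the directions lie in the unit ball. The two signs of `c` give the absolute value. -/
theorem gapBound_of_notMem_deviationEvent (hε : 0 < ε) (hγ : 0 ≤ γ)
    (hf : ConvexOn ℝ Set.univ f) (xs : Vec d) {T : ℕ} (hT : 1 ≤ T) {δ L : ℝ} (hδ : 0 < δ)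
    (hδ1 : δ < 1) (hL : 0 < L) {ω : Ω}
    (hsub : ∀ t, IsSubgradientAt f (iter x₀ ε γ (fun k => g k ω) t) ((μ[g t | ℱ t]) ω))
    (hb : ∀ t, ‖g t ω‖ ≤ l (iter x₀ ε γ (fun k => g k ω) t))
    (hlL : ∀ t ≤ T, l (iter x₀ ε γ (fun k => g k ω) t) ≤ L)
    (hdev : ∀ j < T + 2,
      ω ∉ deviationEvent μ ℱ l x₀ ε γ xs L T g (scale L j) (scaleLevel δ j) ∧
      ω ∉ deviationEvent μ ℱ l x₀ ε γ xs L T g (-scale L j) (scaleLevel δ j)) :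
    GapBound 40 f x₀ ε γ xs δ L T (fun k => g k ω) := by
  refine gapBound_of_noise_bound hε hγ hf hsub hT fun τ hτT hτ k hk => ?_
  have hV := norm_accum_sq (fun k => g k ω) τ
  refine abs_le_of_scales hτ hδ hδ1 hL (sq_nonneg _) ?_ fun j hj => ?_
  · rw [hV]
    calc _ ≤ ∑ _t ∈ Finset.range (τ + 1), L ^ 2 := Finset.sum_le_sum fun t ht =>
          pow_le_pow_left₀ (norm_nonneg _)
            ((hb t).trans (hlL t ((Nat.lt_succ_iff.1 (Finset.mem_range.1 ht)).trans hτT))) 2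
      _ = _ := by simp
  have hdir : ∀ c : ℝ, ω ∉ deviationEvent μ ℱ l x₀ ε γ xs L T g c (scaleLevel δ j) →
      c * ∑ i ∈ Finset.range k,
        inner ℝ (unitDisp x₀ ε γ (fun k => g k ω) xs i) (g i ω - (μ[g i | ℱ i]) ω)
      ≤ 2 * c ^ 2 * ‖accum (fun k => g k ω) τ‖ ^ 2 + scaleLevel δ j := by
    intro c hc
    have h1 : ∀ k ≤ T, ∑ i ∈ Finset.range k,
        (inner ℝ (truncDisp l x₀ ε γ xs L c (fun k => g k ω) i) (g i ω - (μ[g i | ℱ i]) ω)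
          - 2 * inner ℝ (truncDisp l x₀ ε γ xs L c (fun k => g k ω) i) (g i ω) ^ 2)
        < scaleLevel δ j := by
      simpa [deviationEvent] using hc
    have h1 := h1 k (hk.trans hτT)
    have h2 : ∀ i ∈ Finset.range k, c * inner ℝ (unitDisp x₀ ε γ (fun k => g k ω) xs i)
          (g i ω - (μ[g i | ℱ i]) ω) - 2 * c ^ 2 * ‖g i ω‖ ^ 2 ≤
        inner ℝ (truncDisp l x₀ ε γ xs L c (fun k => g k ω) i) (g i ω - (μ[g i | ℱ i]) ω)
          - 2 * inner ℝ (truncDisp l x₀ ε γ xs L c (fun k => g k ω) i) (g i ω) ^ 2 := by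
      intro i hi
      have hiT : i ≤ T := by have := Finset.mem_range.1 hi; omega
      have h3 : inner ℝ (unitDisp x₀ ε γ (fun k => g k ω) xs i) (g i ω) ^ 2 ≤ ‖g i ω‖ ^ 2 := by
        rw [← sq_abs]
        refine pow_le_pow_left₀ (abs_nonneg _) ((abs_real_inner_le_norm _ _).trans ?_) 2
        exact mul_le_of_le_one_left (norm_nonneg _) (norm_unitDisp_le _ _ _ _ _ _)
      rw [truncDisp, if_pos (hlL i hiT), real_inner_smul_left, real_inner_smul_left, mul_pow]
      nlinarith [mul_le_mul_of_nonneg_left h3 (sq_nonneg c)]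
    have h4 := (Finset.sum_le_sum h2).trans_lt h1
    rw [Finset.sum_sub_distrib, ← Finset.mul_sum, ← Finset.mul_sum] at h4
    have h5 : ∑ i ∈ Finset.range k, ‖g i ω‖ ^ 2 ≤ ‖accum (fun k => g k ω) τ‖ ^ 2 := by
      rw [hV]
      exact Finset.sum_le_sum_of_subset_of_nonneg (Finset.range_mono (by omega))
        fun _ _ _ => sq_nonneg _
    have h6 := mul_le_mul_of_nonneg_left h5 (show 0 ≤ 2 * c ^ 2 by positivity)
    linarith
  have hp := hdir _ (hdev j (by omega)).1
  have hn := hdir _ (hdev j (by omega)).2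
  rw [neg_sq] at hn
  rw [← abs_of_pos (scale_pos hL j), ← abs_mul, abs_of_pos (scale_pos hL j), abs_le]
  constructor <;> linarith

end Noise

end AdaGradPP

/-! ### Union bound over scales and signs. -/

theorem theorem1 :
    ∃ C : ℝ, 0 < C ∧
      ∀ (d : ℕ) (Ω : Type*) (mΩ : MeasurableSpace Ω) (μ : Measure Ω) (_ : IsProbabilityMeasure μ)
        (ℱ : Filtration ℕ mΩ)
        (f : AdaGradPP.Vec d → ℝ) (_ : ConvexOn ℝ Set.univ f)
        (l : AdaGradPP.Vec d → ℝ) (_ : Continuous l)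
        (x₀ : AdaGradPP.Vec d) (ε γ : ℝ) (_ : 0 < ε) (_ : 0 ≤ γ)
        (g : ℕ → Ω → AdaGradPP.Vec d) (_ : AdaGradPP.IsOracleRun μ ℱ f x₀ ε γ g)
        (_ : ∀ t, ∀ᵐ ω ∂μ, ‖g t ω‖ ≤ l (AdaGradPP.iter x₀ ε γ (fun k => g k ω) t))
        (T : ℕ) (_ : 1 ≤ T) (δ L : ℝ) (_ : 0 < δ) (_ : δ < 1) (_ : 0 < L)
        (xs : AdaGradPP.Vec d),
        1 - δ - μ.real {ω | L <
            AdaGradPP.runMax (fun t => l (AdaGradPP.iter x₀ ε γ (fun k => g k ω) t)) T} ≤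
          μ.real {ω | AdaGradPP.GapBound C f x₀ ε γ xs δ L T (fun k => g k ω)} := by
  refine ⟨40, by norm_num, ?_⟩
  intro d Ω mΩ μ _ ℱ f hf l hl x₀ ε γ hε hγ g hrun hb T hT δ L hδ hδ1 hL xs
  set large := {ω | L <
    AdaGradPP.runMax (fun t => l (AdaGradPP.iter x₀ ε γ (fun k => g k ω) t)) T}
  set good := {ω | AdaGradPP.GapBound 40 f x₀ ε γ xs δ L T (fun k => g k ω)}
  let dev : ℝ → ℕ → Set Ω := fun c j => AdaGradPP.deviationEvent μ ℱ l x₀ ε γ xs L T g c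
    (AdaGradPP.scaleLevel δ j)
  set bad : Set Ω := ⋃ j ∈ Finset.range (T + 2),
    (dev (AdaGradPP.scale L j) j ∪ dev (-AdaGradPP.scale L j) j)
  have hbadδ : μ.real bad ≤ δ := by
    refine (measureReal_biUnion_finset_le _ _).trans
      (le_trans (Finset.sum_le_sum fun j _ => ?_) (AdaGradPP.sum_exp_neg_scaleLevel_le hδ (T + 2)))
    have hs : |AdaGradPP.scale L j| * L ≤ 1 / 2 := by
      rw [abs_of_pos (AdaGradPP.scale_pos hL j)]
      exact AdaGradPP.scale_mul_le hL j
    rw [two_mul]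
    exact (measureReal_union_le _ _).trans (add_le_add
      (AdaGradPP.measureReal_deviationEvent_le hl hε hγ hrun.measurable hb xs hs T _)
      (AdaGradPP.measureReal_deviationEvent_le hl hε hγ hrun.measurable hb xs
        (by rwa [abs_neg]) T _))
  -- An almost sure covering and subadditivity suffice, so measurability of the three events is not
  -- needed.
  have hcover : ∀ᵐ ω ∂μ, ω ∈ bad ∪ large ∪ good := by
    filter_upwards [ae_all_iff.2 hrun.subgradient, ae_all_iff.2 hb] with ω hsub hbω
    by_cases h1 : ω ∈ bad
    · exact Or.inl (Or.inl h1)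
    by_cases h2 : ω ∈ large
    · exact Or.inl (Or.inr h2)
    refine Or.inr (AdaGradPP.gapBound_of_notMem_deviationEvent hε hγ hf xs hT hδ hδ1 hL hsub hbω
      (fun t ht => (AdaGradPP.le_runMax
        (fun t => l (AdaGradPP.iter x₀ ε γ (fun k => g k ω) t)) ht).trans (not_lt.1 h2))
      fun j hj => ?_)
    have h3 : ω ∉ dev (AdaGradPP.scale L j) j ∪ dev (-AdaGradPP.scale L j) j := fun h =>
      h1 (Set.mem_biUnion (Finset.mem_coe.2 (Finset.mem_range.2 hj)) h)
    exact ⟨fun h => h3 (Or.inl h), fun h => h3 (Or.inr h)⟩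
  have hone : μ.real (bad ∪ large ∪ good) = 1 := by
    have h : μ.real (bad ∪ large ∪ good) = μ.real Set.univ :=
      measureReal_congr (Filter.eventuallyEq_univ.2 hcover)
    rw [h, probReal_univ]
  have h1 := measureReal_union_le (μ := μ) (bad ∪ large) good
  have h2 := measureReal_union_le (μ := μ) bad large
  linarith
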